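/- For a finite simple undirected graph $\Gamma$ whose distinct vertex degrees (valencies) are $k_1 > \dots > k_r$, with $n_i$ the number of vertices of degree $k_i$, the \emph{valency-array} of $\Gamma$ is the tuple $(n_1,\dots,n_r;k_1,\dots,k_r)$. The \emph{spectrum} of $\Gamma$ is the multiset of eigenvalues of its adjacency matrix; we write $\{[\theta_0]^{m_0},[\theta_1]^{m_1},\dots\}$ when the distinct eigenvalues are $\theta_0,\theta_1,\dots$ with multiplicities $m_0,m_1,\dots$. There is no finite simple undirected graph with valency-array $(22,22;22,7)$ and spectrum $\{[19]^1,[2]^{22},[-3]^{21}\}$. -/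

import Mathlib

/-- `G.HasValencyArray n k` says that the valency-array of the finite graph `G` is
`(n 0, …, n (r-1); k 0, …, k (r-1))`: the distinct valencies (degrees) of the vertices of `G` are
exactly `k 0 > ⋯ > k (r-1)`, and the valency `k i` is attained by exactly `n i` vertices. -/
def SimpleGraph.HasValencyArray {V : Type*} [Fintype V] (G : SimpleGraph V) [DecidableRel G.Adj]
    {r : ℕ} (n k : Fin r → ℕ) : Prop :=
  StrictAnti k ∧ Set.range (fun v => G.degree v) = Set.range k ∧
    ∀ i, (Finset.univ.filter fun v => G.degree v = k i).card = n i

/-- The spectrum of a finite graph: the multiset of eigenvalues of its (real symmetric) adjacency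
matrix, counted with multiplicity, that is, the real roots of the characteristic polynomial. -/
noncomputable def SimpleGraph.adjSpectrum {V : Type*} [Fintype V] [DecidableEq V]
    (G : SimpleGraph V) [DecidableRel G.Adj] : Multiset ℝ :=
  (G.adjMatrix ℝ).charpoly.roots

section

open Finset

/-! Let `A` be the adjacency matrix. The eigenvalues 2 and -3 are the roots of t² + t - 6, and 19 is
simple, so A² + A - 6 = w wᵀ. The diagonal gives w(v)² = deg v - 6, so |w| is 1 or 4, and the number
of common neighbours of two vertices is known up to adjacency. Row sums then fix how many neighbours
of each valency a vertex has.

Take the valency-7 vertices as points and the valency-22 vertices as lines. The points induce a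
cubic graph on 22 vertices, and counting lines rules out cycles of length 3 to 6 (`no_pentagon`,
`no_hexagon`). Since 22 = 1 + 3 + 6 + 12, this would be a cubic Moore graph of diameter 3. Its
adjacency matrix satisfies B³ = J + 2 - B² + 4B (`adjMatrix_pow_three`), which forces tr B⁷ = 528.
But tr B⁷ ≡ (tr B)⁷ = 0 modulo 7, a contradiction. -/

/-- Six vertices forming a closed walk without backtracking. -/
structure SimpleGraph.IsHexagon {P : Type*} (T : SimpleGraph P) (a b c d e f : P) : Prop where
  ab : T.Adj a b
  bc : T.Adj b c
  cd : T.Adj c d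
  de : T.Adj d e
  ef : T.Adj e f
  fa : T.Adj f a
  ac : a ≠ c
  bd : b ≠ d
  ce : c ≠ e
  df : d ≠ f
  ea : e ≠ a
  fb : f ≠ b

theorem SimpleGraph.IsHexagon.rotate {P : Type*} {T : SimpleGraph P} {a b c d e f : P}
    (H : T.IsHexagon a b c d e f) : T.IsHexagon b c d e f a :=
  ⟨H.bc, H.cd, H.de, H.ef, H.fa, H.ab, H.bd, H.ce, H.df, H.ea, H.fb, H.ac⟩

/-- A cubic graph `T` on 22 points together with 22 lines (`L v` is the set of lines through `v`),
four on each point and four points on each, such that any two distinct points are in exactly one of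
the relations: adjacent, having a common neighbour, being on a common line (the last two in a unique
way). -/
structure IsPointLineConfig {P Λ : Type*} [Fintype P] [DecidableEq P] [Fintype Λ] [DecidableEq Λ]
    (T : SimpleGraph P) [DecidableRel T.Adj] (L : P → Finset Λ) : Prop where
  degree_eq : ∀ v, T.degree v = 3
  card_lines : ∀ v, (L v).card = 4
  card_points : ∀ l, (univ.filter fun v => l ∈ L v).card = 4
  card_point : Fintype.card P = 22
  card_line : Fintype.card Λ = 22
  meet : ∀ v w, v ≠ w → (T.neighborFinset v ∩ T.neighborFinset w).card + (L v ∩ L w).card +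
    (if T.Adj v w then 1 else 0) = 1

namespace IsPointLineConfig

variable {P Λ : Type*} [Fintype P] [DecidableEq P] [Fintype Λ] [DecidableEq Λ]
  {T : SimpleGraph P} [DecidableRel T.Adj] {L : P → Finset Λ}

/-! ### Excluding short cycles -/

theorem triangle_free (h : IsPointLineConfig T L) {a b c : P} (hab : T.Adj a b) (hac : T.Adj a c)
    (hbc : T.Adj b c) : False := by
  have := h.meet a b hab.ne
  have h1 : 0 < (T.neighborFinset a ∩ T.neighborFinset b).card :=
    card_pos.2 ⟨c, by simp [hac, hbc]⟩
  rw [if_pos hab] at this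
  omega

theorem eq_of_common_neighbors (h : IsPointLineConfig T L) {a b c d : P} (hne : a ≠ b)
    (hac : T.Adj a c) (hbc : T.Adj b c) (had : T.Adj a d) (hbd : T.Adj b d) : c = d := by
  have := h.meet a b hne
  have h1 : (T.neighborFinset a ∩ T.neighborFinset b).card ≤ 1 := by omega
  exact card_le_one.1 h1 c (by simp [hac, hbc]) d (by simp [had, hbd])

theorem card_inter_lines_le (h : IsPointLineConfig T L) {a b : P} (hne : a ≠ b) :
    (L a ∩ L b).card ≤ 1 := by
  have := h.meet a b hne
  omega

theorem disjoint_of_adj (h : IsPointLineConfig T L) {a b : P} (hab : T.Adj a b) :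
    Disjoint (L a) (L b) := by
  have := h.meet a b hab.ne
  rw [if_pos hab] at this
  rw [disjoint_iff_inter_eq_empty, ← card_eq_zero]
  omega

theorem disjoint_of_common (h : IsPointLineConfig T L) {a b c : P} (hne : a ≠ b)
    (hac : T.Adj a c) (hcb : T.Adj c b) : Disjoint (L a) (L b) := by
  have := h.meet a b hne
  have h1 : 0 < (T.neighborFinset a ∩ T.neighborFinset b).card :=
    card_pos.2 ⟨c, by simp [hac, hcb.symm]⟩
  rw [disjoint_iff_inter_eq_empty, ← card_eq_zero]
  omega

theorem exists_third_neighbor (h : IsPointLineConfig T L) (v a b : P) :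
    ∃ q, T.Adj v q ∧ q ≠ a ∧ q ≠ b := by
  have h1 : ({a, b} : Finset P).card < (T.neighborFinset v).card := by
    rw [T.card_neighborFinset_eq_degree, h.degree_eq]
    exact (card_le_two).trans_lt (by norm_num)
  obtain ⟨q, hq, hq'⟩ := exists_mem_notMem_of_card_lt_card h1
  simp at hq hq'
  exact ⟨q, hq, hq'.1, hq'.2⟩

/-- Vertices of a pentagon are pairwise at distance 1 or 2, so their line sets are disjoint and
cover 20 of the 22 lines. The third neighbours of two adjacent vertices must each contain both
remaining lines, but two points share at most one. -/
theorem no_pentagon (h : IsPointLineConfig T L) {a b c d e : P} (hab : T.Adj a b)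
    (hbc : T.Adj b c) (hcd : T.Adj c d) (hde : T.Adj d e) (hea : T.Adj e a)
    (hac : a ≠ c) (hbd : b ≠ d) (hce : c ≠ e) (hda : d ≠ a) (heb : e ≠ b) : False := by
  obtain ⟨q, haq, hqb, hqe⟩ := h.exists_third_neighbor a b e
  obtain ⟨r, hbr, hra, hrc⟩ := h.exists_third_neighbor b a c
  set U := L a ∪ L b ∪ L c ∪ L d ∪ L e with hU
  have dab := h.disjoint_of_adj hab
  have dbc := h.disjoint_of_adj hbc
  have dcd := h.disjoint_of_adj hcd
  have dde := h.disjoint_of_adj hde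
  have dea := h.disjoint_of_adj hea
  have dac := h.disjoint_of_common hac hab hbc
  have dbd := h.disjoint_of_common hbd hbc hcd
  have dce := h.disjoint_of_common hce hcd hde
  have dda := h.disjoint_of_common hda hde hea
  have deb := h.disjoint_of_common heb hea hab
  have cU : U.card = 20 := by
    rw [hU, card_union_of_disjoint, card_union_of_disjoint, card_union_of_disjoint,
      card_union_of_disjoint dab] <;>
    simp only [disjoint_union_left, h.card_lines, dac, dbc, dbd, dcd, dde, dce, dda.symm,
      dea.symm, deb.symm, and_self]
  have cUc : Uᶜ.card = 2 := by rw [card_compl, cU, h.card_line]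
  -- a point with two of the five points collinear to it lies on both lines of the complement
  have key : ∀ x s t, x ≠ s → x ≠ t → L x ∩ U ⊆ (L x ∩ L s) ∪ (L x ∩ L t) → Uᶜ ⊆ L x := by
    intro x s t hs ht hsub
    have h1 := (card_le_card hsub).trans (card_union_le _ _)
    have h2 := h.card_inter_lines_le hs
    have h3 := h.card_inter_lines_le ht
    have h4 := card_inter_add_card_sdiff (L x) U
    rw [h.card_lines] at h4
    have h5 : L x \ U ⊆ Uᶜ := fun l hl => by simp at hl ⊢; exact hl.2
    have h6 := eq_of_subset_of_card_le h5 (by omega)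
    rw [← h6]
    exact sdiff_subset
  have hq : Uᶜ ⊆ L q := by
    refine key q c d ?_ ?_ ?_
    · rintro rfl; exact h.triangle_free hab haq hbc
    · rintro rfl; exact h.triangle_free hea.symm haq hde.symm
    · have e1 := disjoint_left.1 (h.disjoint_of_adj haq)
      have e2 := disjoint_left.1 (h.disjoint_of_common hqb haq.symm hab)
      have e3 := disjoint_left.1 (h.disjoint_of_common hqe haq.symm hea.symm)
      intro l hl
      simp only [hU, mem_inter, mem_union] at hl ⊢
      have := @e1 l; have := @e2 l; have := @e3 l
      tauto
  have hr : Uᶜ ⊆ L r := by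
    refine key r d e ?_ ?_ ?_
    · rintro rfl; exact h.triangle_free hbc hbr hcd
    · rintro rfl; exact h.triangle_free hab.symm hbr hea.symm
    · have e1 := disjoint_left.1 (h.disjoint_of_adj hbr)
      have e2 := disjoint_left.1 (h.disjoint_of_common hra hbr.symm hab.symm)
      have e3 := disjoint_left.1 (h.disjoint_of_common hrc hbr.symm hbc)
      intro l hl
      simp only [hU, mem_inter, mem_union] at hl ⊢
      have := @e1 l; have := @e2 l; have := @e3 l
      tauto
  have hqr : q ≠ r := by rintro rfl; exact h.triangle_free hab haq hbr
  have := h.card_inter_lines_le hqr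
  have := card_le_card (subset_inter hq hr)
  omega

/-- The third neighbour of a vertex of a hexagon lies on a line missing the hexagon. -/
theorem exists_line_missing_hexagon (h : IsPointLineConfig T L) {a b c d e f q : P}
    (H : T.IsHexagon a b c d e f) (haq : T.Adj a q) (hqb : q ≠ b) (hqf : q ≠ f) :
    ∃ l ∈ L q, l ∉ L a ∪ L b ∪ L c ∪ L d ∪ L e ∪ L f := by
  by_contra! hcon
  have e1 := disjoint_left.1 (h.disjoint_of_adj haq)
  have e2 := disjoint_left.1 (h.disjoint_of_common hqb haq.symm H.ab)
  have e3 := disjoint_left.1 (h.disjoint_of_common hqf haq.symm H.fa.symm)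
  -- Only `c`, `d`, `e` can share lines with `q`, at most one each, which cannot account for four
  -- lines.
  have hsub : L q ⊆ (L q ∩ L c) ∪ (L q ∩ L d) ∪ (L q ∩ L e) := by
    intro l hl
    have h0 := hcon l hl
    simp only [mem_inter, mem_union] at h0 ⊢
    have := @e1 l; have := @e2 l; have := @e3 l
    tauto
  have hqc : q ≠ c := by rintro rfl; exact h.triangle_free H.ab haq H.bc
  have hqe : q ≠ e := by rintro rfl; exact h.triangle_free H.fa.symm haq H.ef.symm
  have hqd : q ≠ d := by
    rintro rfl
    exact hqb (h.eq_of_common_neighbors H.ac haq H.cd H.ab H.bc.symm)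
  have h1 := h.card_inter_lines_le hqc
  have h2 := h.card_inter_lines_le hqd
  have h3 := h.card_inter_lines_le hqe
  have h4 := (card_le_card hsub).trans (card_union_le _ _)
  have h5 := card_union_le (L q ∩ L c) (L q ∩ L d)
  rw [h.card_lines] at h4
  omega

/-- Only the three opposite pairs can share a line, at most one each: 24 - 3 = 21. -/
theorem card_lines_hexagon (h : IsPointLineConfig T L) {a b c d e f : P}
    (H : T.IsHexagon a b c d e f) : 21 ≤ (L a ∪ L b ∪ L c ∪ L d ∪ L e ∪ L f).card := by
  have had : a ≠ d := by rintro rfl; exact h.triangle_free H.ab H.cd.symm H.bc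
  have hbe : b ≠ e := by rintro rfl; exact h.triangle_free H.bc H.de.symm H.cd
  have hcf : c ≠ f := by rintro rfl; exact h.triangle_free H.cd H.ef.symm H.de
  have dab := h.disjoint_of_adj H.ab
  have dbc := h.disjoint_of_adj H.bc
  have dcd := h.disjoint_of_adj H.cd
  have dde := h.disjoint_of_adj H.de
  have def' := h.disjoint_of_adj H.ef
  have dfa := h.disjoint_of_adj H.fa
  have dac := h.disjoint_of_common H.ac H.ab H.bc
  have dbd := h.disjoint_of_common H.bd H.bc H.cd
  have dce := h.disjoint_of_common H.ce H.cd H.de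
  have ddf := h.disjoint_of_common H.df H.de H.ef
  have dea := h.disjoint_of_common H.ea H.ef H.fa
  have dfb := h.disjoint_of_common H.fb H.fa H.ab
  have e1 := card_union_add_card_inter (L a) (L d)
  have e2 := card_union_add_card_inter (L b) (L e)
  have e3 := card_union_add_card_inter (L c) (L f)
  have i1 := h.card_inter_lines_le had
  have i2 := h.card_inter_lines_le hbe
  have i3 := h.card_inter_lines_le hcf
  simp only [h.card_lines] at e1 e2 e3
  have hU : L a ∪ L b ∪ L c ∪ L d ∪ L e ∪ L f =
      (L a ∪ L d) ∪ (L b ∪ L e) ∪ (L c ∪ L f) := by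
    ext l; simp only [mem_union]; tauto
  rw [hU, card_union_of_disjoint, card_union_of_disjoint]
  · omega
  · simp only [disjoint_union_left, disjoint_union_right, dab, dbd.symm, dde, dea.symm, and_self]
  · simp only [disjoint_union_left, disjoint_union_right, dac, dbc, dcd.symm, dfa.symm, ddf,
      dfb.symm, dce.symm, def', and_self]

/-- At most one line misses the hexagon, and the third neighbour of every hexagon vertex lies on it.
Five of these neighbours already exceed the four points of a line. -/
theorem no_hexagon (h : IsPointLineConfig T L) {a b c d e f : P}
    (H : T.IsHexagon a b c d e f) : False := by
  set U := L a ∪ L b ∪ L c ∪ L d ∪ L e ∪ L f with hU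
  have hUc : Uᶜ.card ≤ 1 := by
    rw [card_compl, h.card_line]
    have : 21 ≤ U.card := h.card_lines_hexagon H
    omega
  have rot : ∀ {a b c d e f : P}, L a ∪ L b ∪ L c ∪ L d ∪ L e ∪ L f = U →
      L b ∪ L c ∪ L d ∪ L e ∪ L f ∪ L a = U := by
    intro a b c d e f h0
    rw [← h0]
    ext l; simp only [mem_union]; tauto
  have key : ∀ {a b c d e f : P}, T.IsHexagon a b c d e f →
      L a ∪ L b ∪ L c ∪ L d ∪ L e ∪ L f = U →
      ∃ q, T.Adj a q ∧ q ≠ b ∧ q ≠ f ∧ ∃ l ∈ L q, l ∈ Uᶜ := by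
    intro a b c d e f H hU
    obtain ⟨q, haq, hqb, hqf⟩ := h.exists_third_neighbor a b f
    obtain ⟨l, hl, hl'⟩ := h.exists_line_missing_hexagon H haq hqb hqf
    exact ⟨q, haq, hqb, hqf, l, hl, by rwa [mem_compl, ← hU]⟩
  have U1 := rot hU.symm
  have U2 := rot U1
  have U3 := rot U2
  have U4 := rot U3
  obtain ⟨q₁, n₁, x₁, y₁, l, hl₁, m⟩ := key H hU.symm
  obtain ⟨q₂, n₂, x₂, y₂, l₂, hl₂, m₂⟩ := key H.rotate U1
  obtain ⟨q₃, n₃, x₃, y₃, l₃, hl₃, m₃⟩ := key H.rotate.rotate U2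
  obtain ⟨q₄, n₄, x₄, y₄, l₄, hl₄, m₄⟩ := key H.rotate.rotate.rotate U3
  obtain ⟨q₅, n₅, x₅, y₅, l₅, hl₅, m₅⟩ := key H.rotate.rotate.rotate.rotate U4
  rw [card_le_one] at hUc
  obtain rfl := hUc _ m _ m₂
  obtain rfl := hUc _ m _ m₃
  obtain rfl := hUc _ m _ m₄
  obtain rfl := hUc _ m _ m₅
  -- A coincidence would close a triangle, a 4-cycle or a pentagon, according to the distance along
  -- the hexagon.
  have d12 : q₁ ≠ q₂ := by rintro rfl; exact h.triangle_free H.ab n₁ n₂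
  have d23 : q₂ ≠ q₃ := by rintro rfl; exact h.triangle_free H.bc n₂ n₃
  have d34 : q₃ ≠ q₄ := by rintro rfl; exact h.triangle_free H.cd n₃ n₄
  have d45 : q₄ ≠ q₅ := by rintro rfl; exact h.triangle_free H.de n₄ n₅
  have d13 : q₁ ≠ q₃ := by
    rintro rfl; exact x₁ (h.eq_of_common_neighbors H.ac n₁ n₃ H.ab H.bc.symm)
  have d24 : q₂ ≠ q₄ := by
    rintro rfl; exact x₂ (h.eq_of_common_neighbors H.bd n₂ n₄ H.bc H.cd.symm)
  have d35 : q₃ ≠ q₅ := by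
    rintro rfl; exact x₃ (h.eq_of_common_neighbors H.ce n₃ n₅ H.cd H.de.symm)
  have d14 : q₁ ≠ q₄ := by
    rintro rfl
    exact h.no_pentagon H.ab H.bc H.cd n₄ n₁.symm H.ac H.bd (Ne.symm y₄)
      (by rintro rfl; exact h.triangle_free H.ab H.cd.symm H.bc) x₁
  have d25 : q₂ ≠ q₅ := by
    rintro rfl
    exact h.no_pentagon H.bc H.cd H.de n₅ n₂.symm H.bd H.ce (Ne.symm y₅)
      (by rintro rfl; exact h.triangle_free H.bc H.de.symm H.cd) x₂
  have d15 : q₁ ≠ q₅ := by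
    rintro rfl; exact y₁ (h.eq_of_common_neighbors H.ea n₅ n₁ H.ef H.fa.symm)
  have hsub : ({q₁, q₂, q₃, q₄, q₅} : Finset P) ⊆ univ.filter fun v => l ∈ L v := by
    intro v hv
    simp only [mem_insert, mem_singleton] at hv
    rw [mem_filter]
    rcases hv with rfl | rfl | rfl | rfl | rfl <;> exact ⟨mem_univ _, by assumption⟩
  have hcard := card_le_card hsub
  rw [h.card_points, card_insert_of_notMem, card_insert_of_notMem, card_insert_of_notMem,
    card_pair d45] at hcard
  · omega
  all_goals simp [*]

/-! ### Walks in the cubic graph and the trace contradiction -/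

/-- The left side counts walks of length 3 from `x` to `y`. Only an upper bound is needed, since
comparing row sums later turns it into an equality. -/
theorem sum_common_neighbors_le (h : IsPointLineConfig T L) (x y : P) :
    (∑ a ∈ T.neighborFinset x, ((T.neighborFinset a ∩ T.neighborFinset y).card : ℤ)) ≤
      1 + (if x = y then 2 else 0) - (T.neighborFinset x ∩ T.neighborFinset y).card +
        4 * (if T.Adj x y then 1 else 0) := by
  have self : ∀ v, (T.neighborFinset v ∩ T.neighborFinset v).card = 3 := fun v => by
    rw [inter_self, T.card_neighborFinset_eq_degree, h.degree_eq]
  have le_one : ∀ a b, a ≠ b → (T.neighborFinset a ∩ T.neighborFinset b).card ≤ 1 :=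
    fun a b hab => by have := h.meet a b hab; omega
  by_cases hxy : x = y
  · subst hxy
    have : ∀ a ∈ T.neighborFinset x,
        ((T.neighborFinset a ∩ T.neighborFinset x).card : ℤ) = 0 := by
      intro a ha
      have ha : T.Adj a x := by simpa using (T.mem_neighborFinset x a |>.1 ha).symm
      have := h.meet a x ha.ne
      rw [if_pos ha] at this
      omega
    rw [sum_eq_zero this, self]
    simp
  rw [if_neg hxy]
  by_cases hadj : T.Adj x y
  · have hy : y ∈ T.neighborFinset x := by simpa using hadj
    have h0 := h.meet x y hxy
    rw [if_pos hadj] at h0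
    have h1 : (T.neighborFinset x ∩ T.neighborFinset y).card = 0 := by omega
    rw [if_pos hadj, h1, ← add_sum_erase _ _ hy, self]
    have h2 : ∑ a ∈ (T.neighborFinset x).erase y,
        ((T.neighborFinset a ∩ T.neighborFinset y).card : ℤ) ≤
        ∑ a ∈ (T.neighborFinset x).erase y, 1 :=
      sum_le_sum fun a ha => by exact_mod_cast le_one a y (ne_of_mem_erase ha)
    rw [sum_const, card_erase_of_mem hy, T.card_neighborFinset_eq_degree, h.degree_eq] at h2
    norm_num at h2 ⊢
    linarith
  rw [if_neg hadj]
  -- At distance two, a walk of length 3 would close a triangle or a pentagon through `c`.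
  by_cases hc : ∃ c, T.Adj x c ∧ T.Adj y c
  · obtain ⟨c, hxc, hyc⟩ := hc
    have h1 := le_one x y hxy
    have : ∀ a ∈ T.neighborFinset x,
        ((T.neighborFinset a ∩ T.neighborFinset y).card : ℤ) = 0 := by
      intro a ha
      have ha : T.Adj x a := by simpa using ha
      rw [Nat.cast_eq_zero, card_eq_zero, eq_empty_iff_forall_notMem]
      intro b hb
      simp only [mem_inter, SimpleGraph.mem_neighborFinset] at hb
      by_cases hac : a = c
      · subst hac
        exact h.triangle_free hyc hb.2 hb.1
      by_cases hbc : b = c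
      · subst hbc
        exact h.triangle_free hxc ha hb.1.symm
      exact h.no_pentagon ha hb.1 hb.2.symm hyc hxc.symm (by rintro rfl; exact hadj hb.2.symm)
        (by rintro rfl; exact hadj ha) hbc (Ne.symm hxy) (Ne.symm hac)
    rw [sum_eq_zero this]
    push_cast
    linarith [(Nat.cast_le (α := ℤ)).2 h1]
  · have h1 : (T.neighborFinset x ∩ T.neighborFinset y).card = 0 := by
      rw [card_eq_zero, eq_empty_iff_forall_notMem]
      intro c hcc
      simp only [mem_inter, SimpleGraph.mem_neighborFinset] at hcc
      exact hc ⟨c, hcc⟩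
    rw [h1]
    -- Two walks leaving `x` through different neighbours would close a 4-cycle or a hexagon.
    by_cases hz : ∀ a ∈ T.neighborFinset x,
        ((T.neighborFinset a ∩ T.neighborFinset y).card : ℤ) = 0
    · rw [sum_eq_zero hz]
      simp
    push Not at hz
    obtain ⟨a, ha, ha'⟩ := hz
    have hxa : T.Adj x a := by simpa using ha
    have hay : a ≠ y := by rintro rfl; exact hadj hxa
    rw [sum_eq_single_of_mem a ha]
    · have := le_one a y hay
      push_cast
      linarith [(Nat.cast_le (α := ℤ)).2 this]
    intro a' ha₂ hne
    have hxa' : T.Adj x a' := by simpa using ha₂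
    rw [Nat.cast_eq_zero, card_eq_zero, eq_empty_iff_forall_notMem]
    intro b' hb'
    have hne0 : (T.neighborFinset a ∩ T.neighborFinset y).Nonempty := by
      rw [← card_pos, Nat.pos_iff_ne_zero]
      exact_mod_cast ha'
    obtain ⟨b, hb⟩ := hne0
    simp only [mem_inter, SimpleGraph.mem_neighborFinset] at hb hb'
    have hbx : b ≠ x := by rintro rfl; exact hadj hb.2.symm
    have hb'x : b' ≠ x := by rintro rfl; exact hadj hb'.2.symm
    by_cases hbb : b = b'
    · subst hbb
      exact hbx (h.eq_of_common_neighbors hne hb'.1 hb.1 hxa'.symm hxa.symm)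
    have hay' : a' ≠ y := by rintro rfl; exact hadj hxa'
    exact h.no_hexagon ⟨hxa, hb.1, hb.2.symm, hb'.2, hb'.1.symm, hxa'.symm, Ne.symm hbx, hay,
      hbb, Ne.symm hay', hb'x, hne⟩

open Matrix in
theorem adjMatrix_pow_three (h : IsPointLineConfig T L) :
    T.adjMatrix ℤ ^ 3 = Matrix.of (fun _ _ => 1) + 2 • (1 : Matrix P P ℤ) - T.adjMatrix ℤ ^ 2 +
      4 • T.adjMatrix ℤ := by
  have sq : ∀ x y, (T.adjMatrix ℤ ^ 2) x y = (T.neighborFinset x ∩ T.neighborFinset y).card := by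
    intro x y
    rw [pow_two, SimpleGraph.adjMatrix_mul_apply]
    simp only [SimpleGraph.adjMatrix_apply, sum_boole]
    congr 2
    ext a
    simp [T.adj_comm a y]
  have cube : ∀ x y, (T.adjMatrix ℤ ^ 3) x y =
      ∑ a ∈ T.neighborFinset x, ((T.neighborFinset a ∩ T.neighborFinset y).card : ℤ) := by
    intro x y
    rw [pow_succ', SimpleGraph.adjMatrix_mul_apply]
    exact sum_congr rfl fun a _ => sq a y
  have row1 : ∀ x, ∑ y, T.adjMatrix ℤ x y = 3 := by
    intro x
    simp only [SimpleGraph.adjMatrix_apply, sum_boole]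
    have := h.degree_eq x
    rw [← T.card_neighborFinset_eq_degree, T.neighborFinset_eq_filter] at this
    exact_mod_cast this
  have row : ∀ n x, ∑ y, (T.adjMatrix ℤ ^ n) x y = 3 ^ n := by
    intro n
    induction n with
    | zero => intro x; simp [Matrix.one_apply]
    | succ n ih =>
      intro x
      simp only [pow_succ', SimpleGraph.adjMatrix_mul_apply]
      rw [sum_comm]
      simp only [ih, sum_const, T.card_neighborFinset_eq_degree, h.degree_eq]
      ring
  have nonneg : ∀ x y, 0 ≤ (1 + 2 * (1 : Matrix P P ℤ) x y - (T.adjMatrix ℤ ^ 2) x y +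
      4 * T.adjMatrix ℤ x y) - (T.adjMatrix ℤ ^ 3) x y := by
    intro x y
    have := h.sum_common_neighbors_le x y
    rw [sub_nonneg, cube, sq, SimpleGraph.adjMatrix_apply, Matrix.one_apply]
    simpa using this
  ext x y
  -- Both sides have row sum 27 = 22 + 2 - 9 + 12, so the nonnegative differences all vanish.
  have hsum : ∑ y, ((1 + 2 * (1 : Matrix P P ℤ) x y - (T.adjMatrix ℤ ^ 2) x y +
      4 * T.adjMatrix ℤ x y) - (T.adjMatrix ℤ ^ 3) x y) = 0 := by
    simp only [sum_add_distrib, sum_sub_distrib, ← mul_sum, row, row1]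
    simp [Matrix.one_apply, h.card_point]
  have := (sum_eq_zero_iff_of_nonneg fun y _ => nonneg x y).1 hsum y (mem_univ _)
  simp only [Matrix.add_apply, Matrix.sub_apply, Matrix.smul_apply, Matrix.of_apply]
  simp only [nsmul_eq_mul]
  push_cast
  linarith

theorem false_of_config (h : IsPointLineConfig T L) : False := by
  set B := T.adjMatrix ℤ with hB
  set J : Matrix P P ℤ := Matrix.of (fun _ _ => 1) with hJ
  have h3 : B ^ 3 = J + 2 • (1 : Matrix P P ℤ) - B ^ 2 + 4 • B := h.adjMatrix_pow_three
  have hJB : J * B = 3 • J := by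
    ext x y
    rw [hB, SimpleGraph.mul_adjMatrix_apply]
    simp [hJ, h.degree_eq]
  have hBB : B * B = B ^ 2 := (pow_two B).symm
  have hB2 : B ^ 2 * B = B ^ 3 := (pow_succ B 2).symm
  -- With JB = 3J, every power of `B` reduces to a combination of J, 1, B and B².
  have h4 : B ^ 4 = 2 • J - 2 • (1 : Matrix P P ℤ) - 2 • B + 5 • B ^ 2 := by
    have : B ^ 4 = J * B + 2 • B - B ^ 3 + 4 • B ^ 2 := by
      conv_lhs => rw [pow_succ B 3, h3]
      simp only [add_mul, sub_mul, smul_mul_assoc, one_mul, hBB, hB2]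
    rw [this, hJB, h3]; module
  have h5 : B ^ 5 = 11 • J + 10 • (1 : Matrix P P ℤ) + 18 • B - 7 • B ^ 2 := by
    have : B ^ 5 = 2 • (J * B) - 2 • B - 2 • B ^ 2 + 5 • B ^ 3 := by
      conv_lhs => rw [pow_succ B 4, h4]
      simp only [add_mul, sub_mul, smul_mul_assoc, one_mul, hBB, hB2]
    rw [this, hJB, h3]; module
  have h6 : B ^ 6 = 26 • J - 14 • (1 : Matrix P P ℤ) - 18 • B + 25 • B ^ 2 := by
    have : B ^ 6 = 11 • (J * B) + 10 • B + 18 • B ^ 2 - 7 • B ^ 3 := by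
      conv_lhs => rw [pow_succ B 5, h5]
      simp only [add_mul, sub_mul, smul_mul_assoc, one_mul, hBB, hB2]
    rw [this, hJB, h3]; module
  have h7 : B ^ 7 = 103 • J + 50 • (1 : Matrix P P ℤ) + 86 • B - 43 • B ^ 2 := by
    have : B ^ 7 = 26 • (J * B) - 14 • B - 18 • B ^ 2 + 25 • B ^ 3 := by
      conv_lhs => rw [pow_succ B 6, h6]
      simp only [add_mul, sub_mul, smul_mul_assoc, one_mul, hBB, hB2]
    rw [this, hJB, h3]; module
  have t2 : (B ^ 2).trace = 66 := by
    rw [Matrix.trace, pow_two]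
    simp only [Matrix.diag_apply, hB, SimpleGraph.adjMatrix_mul_self_apply_self, h.degree_eq,
      sum_const, card_univ, h.card_point]
    norm_num
  have tJ : J.trace = 22 := by simp [Matrix.trace, hJ, h.card_point]
  have t7 : (B ^ 7).trace = 528 := by
    rw [h7, Matrix.trace_sub, Matrix.trace_add, Matrix.trace_add, Matrix.trace_smul,
      Matrix.trace_smul, Matrix.trace_smul, Matrix.trace_smul, tJ, t2, Matrix.trace_one,
      h.card_point, hB, SimpleGraph.trace_adjMatrix]
    norm_num
  -- Modulo a prime p, tr(Bᵖ) = (tr B)ᵖ. Here tr B = 0, while 528 = 7 · 75 + 3.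
  have : Fact (Nat.Prime 7) := ⟨by norm_num⟩
  have hmod := ZMod.trace_pow_card (p := 7) ((Int.castRingHom (ZMod 7)).mapMatrix B)
  rw [← map_pow, RingHom.mapMatrix_apply, RingHom.mapMatrix_apply] at hmod
  have e1 := AddMonoidHom.map_trace (Int.castRingHom (ZMod 7)) (B ^ 7)
  have e2 := AddMonoidHom.map_trace (Int.castRingHom (ZMod 7)) B
  rw [← e1, ← e2, t7, hB, SimpleGraph.trace_adjMatrix] at hmod
  rw [map_zero, zero_pow (by norm_num)] at hmod
  have h528 : ((528 : ℤ) : ZMod 7) = 0 := hmod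
  rw [ZMod.intCast_zmod_eq_zero_iff_dvd] at h528
  omega

end IsPointLineConfig

/-! ### From the spectrum to common-neighbour counts -/

/-- If `19` is a simple eigenvalue of a real symmetric matrix and the others are `2` and `-3`, then
`A² + A - 6` has rank one. -/
theorem Matrix.exists_sq_add_sub_eq {V : Type*} [Fintype V] [DecidableEq V] {A : Matrix V V ℝ}
    (hA : A.IsHermitian) {m n : ℕ}
    (hs : A.charpoly.roots = Multiset.replicate 1 (19 : ℝ) + Multiset.replicate m (2 : ℝ) +
        Multiset.replicate n (-3 : ℝ)) :
    ∃ w : V → ℝ, ∀ x y, (A * A) x y + A x y - 6 * (1 : Matrix V V ℝ) x y = w x * w y := by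
  rw [hA.roots_charpoly_eq_eigenvalues] at hs
  have hcount := congrArg (Multiset.count (19 : ℝ)) hs
  rw [Multiset.count_map] at hcount
  have h19 : (univ.filter fun i => 19 = hA.eigenvalues i).card = 1 := by
    rw [Finset.card_def, Finset.filter_val]
    simp only [Function.comp_apply, RCLike.ofReal_real_eq_id, id] at hcount
    rw [hcount]
    simp [Multiset.count_replicate]
    norm_num
  obtain ⟨i₀, hi₀⟩ := Finset.card_eq_one.1 h19
  -- 374 = 19² + 19 - 6.
  have hval : ∀ i, hA.eigenvalues i * hA.eigenvalues i + hA.eigenvalues i - 6 =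
      if i = i₀ then 374 else 0 := by
    intro i
    have hmem : hA.eigenvalues i ∈ Multiset.map (RCLike.ofReal ∘ hA.eigenvalues)
        (Finset.univ : Finset V).val :=
      Multiset.mem_map.2 ⟨i, mem_univ_val i, by simp⟩
    rw [hs] at hmem
    have hiff : 19 = hA.eigenvalues i ↔ i = i₀ := by
      have := Finset.ext_iff.1 hi₀ i
      simpa using this
    simp only [Multiset.mem_add, Multiset.mem_replicate] at hmem
    split_ifs with hi
    · rw [← hiff.2 hi]; norm_num
    · rcases hmem with (⟨-, h⟩ | ⟨-, h⟩) | ⟨-, h⟩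
      · exact absurd (hiff.1 h.symm) hi
      all_goals rw [h]; norm_num
  set U : Matrix V V ℝ := (hA.eigenvectorUnitary : Matrix V V ℝ) with hU
  set φ := Unitary.conjStarAlgAut ℝ (Matrix V V ℝ) hA.eigenvectorUnitary with hφ
  set D : Matrix V V ℝ := Matrix.diagonal (RCLike.ofReal ∘ hA.eigenvalues) with hD
  have hAD : A = φ D := hA.spectral_theorem
  have hpoly : A * A + A - (6 : ℝ) • (1 : Matrix V V ℝ) =
      φ (Matrix.diagonal fun i => if i = i₀ then 374 else 0) := by
    have : Matrix.diagonal (fun i => if i = i₀ then (374 : ℝ) else 0) =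
        D * D + D - (6 : ℝ) • (1 : Matrix V V ℝ) := by
      rw [hD, Matrix.diagonal_mul_diagonal, Matrix.diagonal_add, Matrix.smul_one_eq_diagonal,
        Matrix.diagonal_sub]
      congr 1
      ext i
      simpa using (hval i).symm
    rw [this, map_sub, map_add, map_mul, map_smul, map_one, ← hAD]
  refine ⟨fun x => √374 * U x i₀, fun x y => ?_⟩
  have hxy := congrFun (congrFun hpoly x) y
  rw [hφ, Unitary.conjStarAlgAut_apply, Matrix.mul_apply] at hxy
  simp only [Matrix.mul_diagonal, mul_ite, mul_zero, ite_mul, zero_mul, sum_ite_eq', mem_univ,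
    if_true] at hxy
  simp only [Matrix.sub_apply, Matrix.add_apply, Matrix.smul_apply, smul_eq_mul] at hxy
  rw [hxy]
  have h374 : √374 * √374 = (374 : ℝ) := Real.mul_self_sqrt (by norm_num)
  simp only [Matrix.star_apply, star_trivial]
  linear_combination (-U x i₀ * U y i₀) * h374

/-- Counting of common neighbours in a graph with two valencies `22` and `7`, when `A² + A - 6` has
rank one. -/
theorem SimpleGraph.card_common_neighbors_add {V : Type*} [Fintype V] [DecidableEq V]
    (G : SimpleGraph V) [DecidableRel G.Adj] (hdeg : ∀ v, G.degree v = 7 ∨ G.degree v = 22)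
    {w : V → ℝ} (hw : ∀ x y, (G.adjMatrix ℝ * G.adjMatrix ℝ) x y + G.adjMatrix ℝ x y -
      6 * (1 : Matrix V V ℝ) x y = w x * w y) {x y : V} (hxy : x ≠ y) :
    (G.neighborFinset x ∩ G.neighborFinset y).card + (if G.Adj x y then 1 else 0) =
      (if G.degree x = 7 then 1 else 4) * (if G.degree y = 7 then 1 else 4) := by
  have hsq : ∀ v, w v ^ 2 = ((if G.degree v = 7 then 1 else 4 : ℕ) : ℝ) ^ 2 := by
    intro v
    have := hw v v
    rw [SimpleGraph.adjMatrix_mul_self_apply_self, SimpleGraph.adjMatrix_apply,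
      if_neg (G.irrefl), Matrix.one_apply_eq] at this
    rw [pow_two, ← this]
    rcases hdeg v with h | h <;> rw [h] <;> norm_num
  have hent : (((G.neighborFinset x ∩ G.neighborFinset y).card +
      (if G.Adj x y then 1 else 0) : ℕ) : ℝ) = w x * w y := by
    rw [← hw x y, SimpleGraph.adjMatrix_mul_apply, Matrix.one_apply_ne hxy]
    simp only [SimpleGraph.adjMatrix_apply, sum_boole]
    push_cast
    rw [mul_zero, sub_zero]
    congr 3
    ext a
    simp [G.adj_comm a y]
  -- The signs of `w` are unknown, but the count is nonnegative, so comparing squares suffices.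
  have : (((G.neighborFinset x ∩ G.neighborFinset y).card +
      (if G.Adj x y then 1 else 0) : ℕ) : ℝ) ^ 2 =
      (((if G.degree x = 7 then 1 else 4) * (if G.degree y = 7 then 1 else 4) : ℕ) : ℝ) ^ 2 := by
    rw [hent, mul_pow, hsq, hsq, Nat.cast_mul, mul_pow]
  exact_mod_cast (pow_left_inj₀ (Nat.cast_nonneg _) (Nat.cast_nonneg _) two_ne_zero).1 this

theorem SimpleGraph.sum_card_common_neighbors {V : Type*} [Fintype V] [DecidableEq V]
    (G : SimpleGraph V) [DecidableRel G.Adj] (x : V) :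
    ∑ y, (G.neighborFinset x ∩ G.neighborFinset y).card =
      ∑ z ∈ G.neighborFinset x, G.degree z := by
  have h1 : ∀ y, (G.neighborFinset x ∩ G.neighborFinset y).card =
      ∑ z ∈ G.neighborFinset x, if G.Adj z y then 1 else 0 := by
    intro y
    rw [sum_boole, Nat.cast_id]
    congr 1
    ext a
    simp [G.adj_comm a y]
  simp_rw [h1]
  rw [sum_comm]
  refine sum_congr rfl fun z _ => ?_
  rw [sum_boole, Nat.cast_id, ← G.card_neighborFinset_eq_degree]
  congr 1
  ext a
  simp

/-- The numbers of neighbours of the two valencies. -/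
theorem SimpleGraph.card_filter_neighborFinset {V : Type*} [Fintype V] [DecidableEq V]
    (G : SimpleGraph V) [DecidableRel G.Adj] (hdeg : ∀ v, G.degree v = 7 ∨ G.degree v = 22)
    (h7 : (univ.filter fun v => G.degree v = 7).card = 22)
    (h22 : (univ.filter fun v => ¬ G.degree v = 7).card = 22)
    (hcom : ∀ x y, x ≠ y →
      (G.neighborFinset x ∩ G.neighborFinset y).card + (if G.Adj x y then 1 else 0) =
        (if G.degree x = 7 then 1 else 4) * (if G.degree y = 7 then 1 else 4)) (x : V) :
    ((G.neighborFinset x).filter fun v => G.degree v = 7).card =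
        (if G.degree x = 7 then 3 else 4) ∧
      ((G.neighborFinset x).filter fun v => ¬ G.degree v = 7).card =
        (if G.degree x = 7 then 4 else 18) := by
  set p := ((G.neighborFinset x).filter fun v => G.degree v = 7).card with hp
  set q := ((G.neighborFinset x).filter fun v => ¬ G.degree v = 7).card with hq
  have hpq : p + q = G.degree x := by
    rw [hp, hq, card_filter_add_card_filter_not, G.card_neighborFinset_eq_degree]
  have hsum : ∑ z ∈ G.neighborFinset x, G.degree z = 7 * p + 22 * q := by
    rw [← sum_filter_add_sum_filter_not _ (fun v => G.degree v = 7),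
      sum_congr rfl (fun v hv => (mem_filter.1 hv).2 : ∀ v ∈ (G.neighborFinset x).filter
        fun v => G.degree v = 7, G.degree v = 7),
      sum_congr rfl (fun v hv => (hdeg v).resolve_left (mem_filter.1 hv).2 :
        ∀ v ∈ (G.neighborFinset x).filter fun v => ¬ G.degree v = 7, G.degree v = 22)]
    simp only [sum_const, smul_eq_mul, ← hp, ← hq]
    ring
  set s : V → ℕ := fun v => if G.degree v = 7 then 1 else 4 with hs
  have hs_sum : ∑ y, s y = 110 := by
    rw [hs, sum_ite]
    simp [h7, h22]
  have hadj : ∑ y, (if G.Adj x y then 1 else 0) = G.degree x := by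
    rw [sum_boole, Nat.cast_id, ← G.card_neighborFinset_eq_degree]
    congr 1
    ext a
    simp
  -- Summing `hcom` over y ≠ x, with the diagonal terms restored, gives a second linear equation in
  -- `p` and `q` besides `hpq`.
  have htot : ∑ y, ((G.neighborFinset x ∩ G.neighborFinset y).card +
      (if G.Adj x y then 1 else 0)) + s x * s x = ∑ y, s x * s y + G.degree x := by
    rw [← add_sum_erase _ _ (mem_univ x), ← add_sum_erase _ (fun y => s x * s y) (mem_univ x),
      sum_congr rfl (fun y hy => hcom x y (ne_of_mem_erase hy).symm), inter_self,
      G.card_neighborFinset_eq_degree, if_neg (G.irrefl)]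
    ring
  rw [sum_add_distrib, G.sum_card_common_neighbors, hsum, hadj, ← mul_sum, hs_sum] at htot
  simp only [hs] at htot
  rcases hdeg x with h | h <;> rw [h] at hpq htot ⊢ <;> norm_num at htot ⊢ <;> omega

end

/-! ### The configuration inside the graph -/

open Finset in
theorem theorem8p4 {V : Type*} [Fintype V] [DecidableEq V]
    (G : SimpleGraph V) [DecidableRel G.Adj] :
    ¬ (G.HasValencyArray ![22, 22] ![22, 7] ∧
      G.adjSpectrum = Multiset.replicate 1 (19 : ℝ) + Multiset.replicate 22 (2 : ℝ) +
        Multiset.replicate 21 (-3 : ℝ)) := by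
  rintro ⟨⟨-, hrange, hcard⟩, hspec⟩
  have hdeg : ∀ v, G.degree v = 7 ∨ G.degree v = 22 := by
    intro v
    have : G.degree v ∈ Set.range ![22, 7] := hrange ▸ Set.mem_range_self v
    obtain ⟨i, hi⟩ := this
    fin_cases i
    · right; simpa using hi.symm
    · left; simpa using hi.symm
  have h7 : (univ.filter fun v => G.degree v = 7).card = 22 := by simpa using hcard 1
  have h22 : (univ.filter fun v => ¬ G.degree v = 7).card = 22 := by
    refine Eq.trans ?_ (hcard 0)
    congr 1
    ext v
    have := hdeg v
    simp only [mem_filter, mem_univ, true_and]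
    change ¬ G.degree v = 7 ↔ G.degree v = 22
    omega
  have hA : (G.adjMatrix ℝ).IsHermitian := by
    rw [Matrix.IsHermitian, Matrix.conjTranspose_eq_transpose_of_trivial]
    exact G.transpose_adjMatrix
  obtain ⟨w, hw⟩ := Matrix.exists_sq_add_sub_eq hA hspec
  have hcom := fun x y (hxy : x ≠ y) => G.card_common_neighbors_add hdeg hw hxy
  have hcnt := G.card_filter_neighborFinset hdeg h7 h22 hcom
  have hT : ∀ v : {v // G.degree v = 7},
      (G.comap (Subtype.val : {v // G.degree v = 7} → V)).neighborFinset v =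
        (G.neighborFinset v).subtype fun v => G.degree v = 7 := by
    intro v; ext a; simp
  -- Points are the valency-7 vertices, lines the valency-22 vertices, and incidence is adjacency.
  refine IsPointLineConfig.false_of_config
    (T := G.comap (Subtype.val : {v // G.degree v = 7} → V))
    (L := fun v => (G.neighborFinset v).subtype fun v => ¬ G.degree v = 7)
    ⟨fun v => ?_, fun v => ?_, fun l => ?_, ?_, ?_, fun v w hvw => ?_⟩
  · rw [← SimpleGraph.card_neighborFinset_eq_degree, hT, card_subtype, (hcnt v).1, if_pos v.2]
  · rw [card_subtype, (hcnt v).2, if_pos v.2]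
  · have h := (hcnt l).1
    rw [if_neg l.2, ← card_subtype] at h
    rw [← h]
    congr 1
    ext a
    simp [G.adj_comm]
  · rw [Fintype.card_subtype, h7]
  · rw [Fintype.card_subtype, h22]
  · have h := hcom v w (Subtype.coe_injective.ne hvw)
    rw [if_pos v.2, if_pos w.2, ← card_filter_add_card_filter_not (fun v => G.degree v = 7),
      ← card_subtype, ← card_subtype] at h
    rw [hT, hT]
    convert h using 3
    · congr 1
      ext a
      simp
    · congr 1
      ext a
      simp
    · exact Iff.rfl
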